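/- Let $A=(A^s)_{s=1}^{d}$ be complex $D\times D$ matrices. Assume that $A$ is in left-canonical form, i.e. $\sum_s (A^s)^\dagger A^s=\mathbb 1$ and there is a positive definite $\rho$ with $\sum_s A^s\rho (A^s)^\dagger=\rho$. Assume also that $A$ is injective: the transfer matrix $\mathbb E=\sum_s A^s\otimes (A^s)^*$ (with $^*$ the entrywise complex conjugate) has an eigenvalue whose eigenspace is one-dimensional and which is strictly larger in modulus than every other eigenvalue of $\mathbb E$. For $N\ge 1$ let $$|\psi_N\rangle=\sum_{s_1,\dots,s_N}\operatorname{Tr}(A^{s_1}\cdots A^{s_N})\,|s_1\cdots s_N\rangle\in(\mathbb C^d)^{\otimes N}$$ be the translation-invariant matrix product state on the periodic chain of $N$ sites generated by $A$. Let $L\ge 1$ and let $G$ be a set of labels (for example a symmetry group). For every $g\in G$ let $U_{g,1},\dots,U_{g,L}$ be unitary $d\times d$ matrices and $\mathcal U_g=\bigotimes_{j=1}^{L}U_{g,j}$. Assume that for every $g\in G$ and every integer $k\ge 1$ there is a real number $\theta_{g,k}$ such that $$\mathcal U_g^{\otimes k}\,|\psi_{kL}\rangle=e^{i\theta_{g,k}}\,|\psi_{kL}\rangle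 ,$$ that is, on the chain of $kL$ sites the state is an eigenstate of the $L$-periodic extension of the modulated symmetry. Then for every $g\in G$ there are unitary $D\times D$ matrices $v_0(g),v_1(g),\dots,v_L(g)$ and real numbers $\phi_1(g),\dots,\phi_L(g),\phi(g)$ such that $$\sum_{t=1}^{d}(U_{g,j})_{st}\,A^t=e^{i\phi_j(g)}\,v_{j-1}(g)^\dagger A^s\,v_j(g)\qquad\text{for all }1\le j\le L,\ 1\le s\le d,$$ and $$v_0(g)=e^{i\phi(g)}\,v_L(g).$$ In the shorthand $\doteq$ for equality up to a phase: $U_{g,j}\cdot A\doteq v_{j-1}(g)^\dagger A\,v_j(g)$ and $v_0(g)\doteq v_L(g)$. -/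

import Mathlib

open Matrix
open scoped Kronecker ComplexOrder

noncomputable section

namespace ModulatedMPS

/-- A site-independent MPS tensor with physical dimension `d` and bond dimension `D`:
a family of square matrices `A s` labelled by the physical index `s`. -/
abbrev Tensor (d D : ℕ) := Fin d → Matrix (Fin D) (Fin D) ℂ

/-- The coordinates, in the product basis, of a vector of the `N`-site space `(ℂ^d)^{⊗ N}`. -/
abbrev State (d N : ℕ) := (Fin N → Fin d) → ℂ

/-- Equality up to a phase: `x = e^{iθ} y` for some real `θ`. -/
def EqUpToPhase {M : Type*} [SMul ℂ M] (x y : M) : Prop :=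
  ∃ θ : ℝ, x = Complex.exp (θ * Complex.I) • y

/-- The translation-invariant periodic MPS on `N` sites, with amplitudes
`Tr (A^{s₁} ⋯ A^{s_N})`. -/
def periodicState {d D : ℕ} (A : Tensor d D) (N : ℕ) : State d N :=
  fun s => Matrix.trace (List.ofFn fun i => A (s i)).prod

/-- The transfer matrix `∑ₛ Aˢ ⊗ (Aˢ)^*`, where `^*` is the entrywise complex conjugate. -/
def transferMatrix {d D : ℕ} (A : Tensor d D) :
    Matrix (Fin D × Fin D) (Fin D × Fin D) ℂ :=
  ∑ s, A s ⊗ₖ (A s).map (starRingEnd ℂ)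

/-- Injectivity: the transfer matrix has a unique dominant eigenvalue (its eigenvector is unique
up to scaling), and every other eigenvalue is strictly smaller in modulus. -/
def IsInjective {d D : ℕ} (A : Tensor d D) : Prop :=
  ∃ μ : ℂ, Module.finrank ℂ (Module.End.eigenspace (Matrix.toLin' (transferMatrix A)) μ) = 1 ∧
    ∀ ν : ℂ, Module.End.HasEigenvalue (Matrix.toLin' (transferMatrix A)) ν → ν ≠ μ → ‖ν‖ < ‖μ‖

/-- Left-canonical form: the identity is the left fixed point of the transfer matrix, and there is
a positive definite (in particular full-rank) right fixed point `ρ`. -/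
structure IsLeftCanonical {d D : ℕ} (A : Tensor d D) : Prop where
  left_fixed : ∑ s, (A s)ᴴ * A s = 1
  right_fixed : ∃ ρ : Matrix (Fin D) (Fin D) ℂ, ρ.PosDef ∧ ∑ s, A s * ρ * (A s)ᴴ = ρ

/-- The matrix of `⨂ᵢ Uᵢ` in the product basis of the `N`-site space. -/
def onSiteOperator {d N : ℕ} (U : Fin N → Matrix.unitaryGroup (Fin d) ℂ) :
    Matrix (Fin N → Fin d) (Fin N → Fin d) ℂ :=
  Matrix.of fun s t => ∏ i, (U i : Matrix (Fin d) (Fin d) ℂ) (s i) (t i)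

/-- The `k`-fold periodic extension of on-site unitaries given on an `L`-site unit cell:
site `i` of the chain of `k * L` sites carries `U (i mod L)`. -/
def periodicExtension {d L : ℕ} (U : Fin L → Matrix.unitaryGroup (Fin d) ℂ) (k : ℕ) :
    Fin (k * L) → Matrix.unitaryGroup (Fin d) ℂ :=
  fun i => U i.modNat

/-- The action `U · A` of an on-site unitary on the physical leg:
`(U · A)^s = ∑ₜ U_{s t} A^t`. -/
def physicalAction {d D : ℕ} (U : Matrix.unitaryGroup (Fin d) ℂ) (A : Tensor d D) : Tensor d D :=
  fun s => ∑ t, (U : Matrix (Fin d) (Fin d) ℂ) s t • A t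

/-- The tensor `v† A w`, with matrices acting on the left and on the right bond. -/
def bondAction {d D : ℕ} (v w : Matrix.unitaryGroup (Fin D) ℂ) (A : Tensor d D) : Tensor d D :=
  fun s => (v : Matrix (Fin D) (Fin D) ℂ)ᴴ * A s * (w : Matrix (Fin D) (Fin D) ℂ)

end ModulatedMPS

end

/-!
The overlap of `ψ_{kL}` with its transform is `Tr Mᵏ`, where `M` is the product over the unit cell
of the mixed transfer matrices of `A` and `U_j · A`, while `‖ψ_{kL}‖² = Tr 𝔼^{kL}` tends to `1`.
Hence `M` has an eigenvalue of modulus at least `1`. As a row vector, a left eigenvector is a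
matrix `X₀` which `M` transports along the cell through `X_j = ∑ₛ (Aˢ)† X_{j-1} (U_j · A)ˢ`. These
steps are contractions for the norm `Tr (X ρ X†)`, so none of them is strict, and the equality case
is the intertwining relation `X_{j-1} (U_j · A)ˢ = Aˢ X_j`. It follows that `X_j† X_j` evolves under
the channel of `A` and returns to itself after one cell; since `𝔼ⁿ` converges to a projection of
rank one, `X_j† X_j` is a multiple of the identity, and the rescaled `X_j` are the bond unitaries.
-/

noncomputable section

namespace ModulatedMPS

open Filter Topology

section MatrixPowers

theorem tendsto_pow_zero_of_forall_spectrum_norm_lt_one {R : Type*} [NormedRing R]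
    [NormedAlgebra ℂ R] [CompleteSpace R] {a : R} (ha : ∀ z ∈ spectrum ℂ a, ‖z‖ < 1) :
    Tendsto (fun k : ℕ => a ^ k) atTop (𝓝 0) := by
  nontriviality R
  have hradius : spectralRadius ℂ a < (1 : NNReal) :=
    spectrum.spectralRadius_lt_of_forall_lt a fun z hz => by exact_mod_cast ha z hz
  obtain ⟨r, har, hr⟩ := ENNReal.lt_iff_exists_nnreal_btwn.mp hradius
  have hroot :=
    (spectrum.pow_nnnorm_pow_one_div_tendsto_nhds_spectralRadius a).eventually_lt_const har
  refine squeeze_zero_norm' ?_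
    (tendsto_pow_atTop_nhds_zero_of_lt_one r.2 (by exact_mod_cast hr))
  filter_upwards [hroot, eventually_gt_atTop 0] with k hk hk0
  have hpow : ((‖a ^ k‖₊ : ENNReal) ^ (1 / k : ℝ)) ^ (k : ℝ) ≤ (r : ENNReal) ^ (k : ℝ) :=
    ENNReal.rpow_le_rpow hk.le (by positivity)
  rw [← ENNReal.rpow_mul, one_div_mul_cancel (by positivity), ENNReal.rpow_one,
    ENNReal.rpow_natCast] at hpow
  exact_mod_cast hpow

theorem sub_pow_succ_of_absorbing {R : Type*} [Ring R] {a p : R} (hap : a * p = p)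
    (hpa : p * a = p) (hp : IsIdempotentElem p) (k : ℕ) :
    (a - p) ^ (k + 1) = a ^ (k + 1) - p := by
  have hpow : ∀ m : ℕ, p * a ^ m = p := fun m => by
    induction m with
    | zero => simp
    | succ m ih => rw [pow_succ, ← mul_assoc, ih, hpa]
  induction k with
  | zero => simp
  | succ k ih =>
    rw [pow_succ', ih, mul_sub, sub_mul, sub_mul, ← pow_succ', hap, hp.eq, hpow, sub_self,
      sub_zero]

theorem tendsto_norm_trace {ι n : Type*} [Fintype n] {l : Filter ι} {f : ι → Matrix n n ℂ}
    {M : Matrix n n ℂ} (hf : Tendsto f l (𝓝 M)) :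
    Tendsto (fun i => ‖(f i).trace‖) l (𝓝 ‖M.trace‖) :=
  ((continuous_id.matrix_trace.tendsto M).comp hf).norm

variable {n : Type*} [Fintype n] [DecidableEq n] {M : Matrix n n ℂ}

theorem exists_vecMul_eq_smul_of_mem_spectrum {z : ℂ} (hz : z ∈ spectrum ℂ M) :
    ∃ x : n → ℂ, x ≠ 0 ∧ x ᵥ* M = z • x := by
  rw [mem_spectrum_iff_isRoot_charpoly, Polynomial.IsRoot, eval_charpoly,
    ← exists_vecMul_eq_zero_iff] at hz
  obtain ⟨x, hx, hzx⟩ := hz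
  rw [vecMul_sub, sub_eq_zero, scalar_apply, ← smul_one_eq_diagonal, vecMul_smul, vecMul_one]
    at hzx
  exact ⟨x, hx, hzx.symm⟩

theorem exists_mulVec_eq_smul_of_mem_spectrum {z : ℂ} (hz : z ∈ spectrum ℂ M) :
    ∃ x : n → ℂ, x ≠ 0 ∧ M *ᵥ x = z • x := by
  rw [← spectrum_toLin'] at hz
  obtain ⟨x, hx⟩ := (Module.End.HasEigenvalue.of_mem_spectrum hz).exists_hasEigenvector
  exact ⟨x, hx.2, hx.apply_eq_smul⟩

theorem tendsto_matrix_pow_zero_of_forall_spectrum_norm_lt_one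
    (hM : ∀ z ∈ spectrum ℂ M, ‖z‖ < 1) : Tendsto (fun k : ℕ => M ^ k) atTop (𝓝 0) := by
  let _ := Matrix.linftyOpNormedRing (n := n) (α := ℂ)
  let _ := Matrix.linftyOpNormedAlgebra (R := ℂ) (n := n) (α := ℂ)
  have : CompleteSpace (Matrix n n ℂ) := FiniteDimensional.complete ℂ _
  exact tendsto_pow_zero_of_forall_spectrum_norm_lt_one hM

theorem exists_mem_spectrum_one_le_norm {ε : ℝ} (hε : 0 < ε)
    (hM : ∃ᶠ k : ℕ in atTop, ε ≤ ‖(M ^ k).trace‖) : ∃ z ∈ spectrum ℂ M, 1 ≤ ‖z‖ := by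
  by_contra! hlt
  have htrace := tendsto_norm_trace (tendsto_matrix_pow_zero_of_forall_spectrum_norm_lt_one hlt)
  rw [trace_zero, norm_zero] at htrace
  obtain ⟨k, hle, hlt⟩ := (hM.and_eventually (htrace.eventually_lt_const hε)).exists
  exact hle.not_gt hlt

theorem norm_lt_one_of_mem_spectrum_sub_vecMulVec {u w : n → ℂ} (hu : M *ᵥ u = u)
    (hw : w ᵥ* M = w) (hwu : w ⬝ᵥ u = 1)
    (hsimple : Module.finrank ℂ (Module.End.eigenspace (toLin' M) 1) = 1)
    (hdom : ∀ z, Module.End.HasEigenvalue (toLin' M) z → z ≠ 1 → ‖z‖ < 1)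
    {z : ℂ} (hz : z ∈ spectrum ℂ (M - vecMulVec u w)) : ‖z‖ < 1 := by
  obtain ⟨x, hx, hzx⟩ := exists_mulVec_eq_smul_of_mem_spectrum hz
  rcases eq_or_ne z 0 with rfl | hz0
  · simp
  have hwx : w ⬝ᵥ x = 0 := by
    have hwzx : w ⬝ᵥ (M - vecMulVec u w) *ᵥ x = 0 := by
      rw [dotProduct_mulVec, vecMul_sub, hw, vecMul_vecMulVec, hwu, one_smul, sub_self,
        zero_dotProduct]
    rw [hzx, dotProduct_smul] at hwzx
    exact (smul_eq_zero.mp hwzx).resolve_left hz0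
  have hMx : x ∈ Module.End.eigenspace (toLin' M) z := by
    rwa [sub_mulVec, vecMulVec_mulVec, hwx, MulOpposite.op_zero, zero_smul, sub_zero,
      ← toLin'_apply, ← Module.End.mem_eigenspace_iff] at hzx
  refine hdom z (Module.End.hasEigenvalue_of_hasEigenvector ⟨hMx, hx⟩) ?_
  rintro rfl
  have hMu : u ∈ Module.End.eigenspace (toLin' M) 1 := by
    rw [Module.End.mem_eigenspace_iff, toLin'_apply, hu, one_smul]
  have hu0 : u ≠ 0 := by
    rintro rfl
    simp at hwu
  obtain ⟨c, hc⟩ :=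
    (finrank_eq_one_iff_of_nonzero' ⟨u, hMu⟩ (by simpa using hu0)).mp hsimple ⟨x, hMx⟩
  obtain rfl : c • u = x := congrArg Subtype.val hc
  rw [dotProduct_smul, hwu, smul_eq_mul, mul_one] at hwx
  exact hx (by rw [hwx, zero_smul])

theorem tendsto_pow_vecMulVec {u w : n → ℂ} (hu : M *ᵥ u = u) (hw : w ᵥ* M = w)
    (hwu : w ⬝ᵥ u = 1)
    (hsimple : Module.finrank ℂ (Module.End.eigenspace (toLin' M) 1) = 1)
    (hdom : ∀ z, Module.End.HasEigenvalue (toLin' M) z → z ≠ 1 → ‖z‖ < 1) :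
    Tendsto (fun k : ℕ => M ^ k) atTop (𝓝 (vecMulVec u w)) := by
  set P := vecMulVec u w with hP
  have hMP : M * P = P := by rw [hP, mul_vecMulVec, hu]
  have hPM : P * M = P := by rw [hP, vecMulVec_mul, hw]
  have hPP : IsIdempotentElem P := by
    rw [IsIdempotentElem, hP, vecMulVec_mul_vecMulVec, hwu, one_smul]
  have hzero := tendsto_matrix_pow_zero_of_forall_spectrum_norm_lt_one fun _ hz =>
    norm_lt_one_of_mem_spectrum_sub_vecMulVec hu hw hwu hsimple hdom hz
  have hlim := ((tendsto_add_atTop_iff_nat 1).mpr hzero).add_const P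
  simp only [← hP, sub_pow_succ_of_absorbing hMP hPM hPP, sub_add_cancel, zero_add] at hlim
  exact (tendsto_add_atTop_iff_nat 1).mp hlim

end MatrixPowers

section ListProducts

theorem prod_ofFn_kronecker {R m n : Type*} [CommSemiring R] [Fintype m] [DecidableEq m]
    [Fintype n] [DecidableEq n] :
    ∀ {N : ℕ} (X : Fin N → Matrix m m R) (Y : Fin N → Matrix n n R),
      (List.ofFn fun i => X i ⊗ₖ Y i).prod = (List.ofFn X).prod ⊗ₖ (List.ofFn Y).prod
  | 0, X, Y => by simp
  | N + 1, X, Y => by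
    simp only [List.ofFn_succ, List.prod_cons, mul_kronecker_mul, prod_ofFn_kronecker]

theorem prod_ofFn_modNat {R : Type*} [Monoid R] {L : ℕ} (X : Fin L → R) :
    ∀ k : ℕ, (List.ofFn fun i : Fin (k * L) => X i.modNat).prod = (List.ofFn X).prod ^ k := by
  intro k
  have hcell : ∀ (i : Fin k) (j : Fin L) (h : (i : ℕ) * L + j < k * L),
      X (Fin.modNat ⟨i * L + j, h⟩) = X j := fun i j h => by
    congr 1
    ext
    simp [Fin.modNat, Nat.mod_eq_of_lt j.2]
  simp only [List.ofFn_mul, hcell, List.ofFn_const, List.prod_flatten, List.map_replicate,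
    List.prod_replicate]

end ListProducts

section Overlap

variable {d D D' N : ℕ}

/-- The periodic matrix product state whose site `i` carries the tensor `A i`. -/
def chainState (A : Fin N → Tensor d D) : State d N :=
  fun s => (List.ofFn fun i => A i (s i)).prod.trace

/-- The mixed transfer matrix `∑ₛ Bˢ ⊗ (Aˢ)^*`, which computes the overlap of the state of `A` with
the state of `B`; the factors are ordered so that `mixedTransfer A B` acts on row vectors `vec X`
with `X` of size `D × D'`. -/
def mixedTransfer (A : Tensor d D) (B : Tensor d D') :
    Matrix (Fin D' × Fin D) (Fin D' × Fin D) ℂ :=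
  ∑ s, B s ⊗ₖ (A s).map (starRingEnd ℂ)

theorem mixedTransfer_self (A : Tensor d D) : mixedTransfer A A = transferMatrix A := rfl

theorem star_chainState_dotProduct_chainState (A : Fin N → Tensor d D) (B : Fin N → Tensor d D') :
    star (chainState A) ⬝ᵥ chainState B =
      (List.ofFn fun i => mixedTransfer (A i) (B i)).prod.trace := by
  have hconj : ∀ X : Fin N → Matrix (Fin D) (Fin D) ℂ,
      (List.ofFn fun i => (X i).map (starRingEnd ℂ)).prod.trace =
        star (List.ofFn X).prod.trace := fun X => by
    have hmap := map_list_prod (starRingEnd ℂ).mapMatrix (List.ofFn X)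
    rw [List.map_ofFn] at hmap
    exact (congrArg trace hmap).symm.trans
      (AddMonoidHom.map_trace (starRingEnd ℂ) (List.ofFn X).prod).symm
  have hexpand := (MultilinearMap.mkPiAlgebraFin ℂ N _).map_sum
    fun i s => B i s ⊗ₖ (A i s).map (starRingEnd ℂ)
  simp only [MultilinearMap.mkPiAlgebraFin_apply] at hexpand
  simp only [mixedTransfer, hexpand, trace_sum, prod_ofFn_kronecker, trace_kronecker, hconj]
  exact Finset.sum_congr rfl fun s _ => mul_comm _ _

theorem onSiteOperator_mulVec_chainState (U : Fin N → unitaryGroup (Fin d) ℂ)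
    (A : Fin N → Tensor d D) :
    onSiteOperator U *ᵥ chainState A = chainState fun i => physicalAction (U i) (A i) := by
  funext s
  have hexpand := (MultilinearMap.mkPiAlgebraFin ℂ N (Matrix (Fin D) (Fin D) ℂ)).map_sum
    fun i t => (U i : Matrix (Fin d) (Fin d) ℂ) (s i) t • A i t
  simp only [MultilinearMap.map_smul_univ, MultilinearMap.mkPiAlgebraFin_apply] at hexpand
  simp only [chainState, physicalAction, hexpand, trace_sum, trace_smul]
  rfl

theorem star_periodicState_dotProduct_self (A : Tensor d D) :
    star (periodicState A N) ⬝ᵥ periodicState A N = (transferMatrix A ^ N).trace := by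
  have h := star_chainState_dotProduct_chainState (fun _ : Fin N => A) fun _ => A
  rwa [List.ofFn_const, List.prod_replicate, mixedTransfer_self] at h

theorem star_periodicState_dotProduct_periodicExtension_mulVec {L : ℕ} (A : Tensor d D)
    (U : Fin L → unitaryGroup (Fin d) ℂ) (k : ℕ) :
    star (periodicState A (k * L)) ⬝ᵥ
        (onSiteOperator (periodicExtension U k) *ᵥ periodicState A (k * L)) =
      ((List.ofFn fun j => mixedTransfer A (physicalAction (U j) A)).prod ^ k).trace := by
  rw [← prod_ofFn_modNat]
  exact (congrArg (star (periodicState A (k * L)) ⬝ᵥ ·)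
    (onSiteOperator_mulVec_chainState (periodicExtension U k) fun _ => A)).trans
      (star_chainState_dotProduct_chainState (fun _ => A) _)

theorem norm_trace_mixedTransfer_pow_eq {L k : ℕ} {A : Tensor d D}
    {U : Fin L → unitaryGroup (Fin d) ℂ}
    (h : EqUpToPhase (onSiteOperator (periodicExtension U k) *ᵥ periodicState A (k * L))
      (periodicState A (k * L))) :
    ‖((List.ofFn fun j => mixedTransfer A (physicalAction (U j) A)).prod ^ k).trace‖ =
      ‖(transferMatrix A ^ (k * L)).trace‖ := by
  obtain ⟨θ, hθ⟩ := h
  rw [← star_periodicState_dotProduct_periodicExtension_mulVec, hθ, dotProduct_smul,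
    star_periodicState_dotProduct_self, norm_smul, Complex.norm_exp_ofReal_mul_I, one_mul]

theorem transferMatrix_physicalAction (U : unitaryGroup (Fin d) ℂ) (A : Tensor d D) :
    transferMatrix (physicalAction U A) = transferMatrix A := by
  have horth : ∀ t t', ∑ s, starRingEnd ℂ ((U : Matrix (Fin d) (Fin d) ℂ) s t') *
      (U : Matrix (Fin d) (Fin d) ℂ) s t = if t' = t then 1 else 0 := fun t t' => by
    have h := congrFun (congrFun (mem_unitaryGroup_iff'.mp U.2) t') t
    rwa [mul_apply, one_apply] at h
  ext ⟨a, b⟩ ⟨a', b'⟩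
  simp only [transferMatrix, physicalAction, Matrix.sum_apply, kronecker_apply, map_apply,
    Matrix.smul_apply, smul_eq_mul, map_sum, map_mul, Finset.sum_mul_sum]
  calc ∑ s, ∑ t, ∑ t', U.1 s t * A t a a' * (starRingEnd ℂ (U.1 s t') * starRingEnd ℂ (A t' b b'))
      = ∑ t, ∑ t', (∑ s, starRingEnd ℂ (U.1 s t') * U.1 s t) *
          (A t a a' * starRingEnd ℂ (A t' b b')) := by
        rw [Finset.sum_comm]
        refine Finset.sum_congr rfl fun t _ => ?_
        rw [Finset.sum_comm]
        refine Finset.sum_congr rfl fun t' _ => ?_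
        rw [Finset.sum_mul]
        refine Finset.sum_congr rfl fun s _ => ?_
        ring
    _ = ∑ t, A t a a' * starRingEnd ℂ (A t b b') := by simp [horth]

end Overlap

section WeightedNorm

variable {m n : Type*} [Fintype m] [Fintype n] {ρ : Matrix n n ℂ}

/-- The square `Tr (X ρ X†)` of the norm on rectangular matrices weighted by `ρ`, for which mixed
channels are contractions; it is a norm when `ρ` is positive definite. -/
def weightedNormSq (ρ : Matrix n n ℂ) (X : Matrix m n ℂ) : ℝ :=
  (X * ρ * Xᴴ).trace.re

theorem weightedNormSq_nonneg (hρ : ρ.PosSemidef) (X : Matrix m n ℂ) : 0 ≤ weightedNormSq ρ X :=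
  (Complex.nonneg_iff.mp (hρ.mul_mul_conjTranspose_same X).trace_nonneg).1

open scoped MatrixOrder Norms.L2Operator in
theorem weightedNormSq_eq_zero_iff (hρ : ρ.PosDef) {X : Matrix m n ℂ} :
    weightedNormSq ρ X = 0 ↔ X = 0 := by
  classical
  refine ⟨fun h => ?_, fun h => by simp [weightedNormSq, h]⟩
  obtain ⟨S, hS, rfl⟩ := CStarAlgebra.isStrictlyPositive_iff_eq_star_mul_self.mp
    hρ.isStrictlyPositive
  have htrace : ((S * Xᴴ)ᴴ * (S * Xᴴ)).trace = 0 := by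
    have hnonneg := (posSemidef_conjTranspose_mul_self (S * Xᴴ)).trace_nonneg
    refine Complex.ext ?_ (Complex.nonneg_iff.mp hnonneg).2.symm
    simpa [weightedNormSq, star_eq_conjTranspose, Matrix.mul_assoc] using h
  rw [trace_conjTranspose_mul_self_eq_zero_iff] at htrace
  lift S to (Matrix n n ℂ)ˣ using hS
  have hX : Xᴴ = 0 := by
    simpa [← Matrix.mul_assoc] using congrArg ((↑S⁻¹ : Matrix n n ℂ) * ·) htrace
  exact conjTranspose_eq_zero.mp hX

theorem weightedNormSq_smul (z : ℂ) (X : Matrix m n ℂ) :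
    weightedNormSq ρ (z • X) = ‖z‖ ^ 2 * weightedNormSq ρ X := by
  rw [weightedNormSq, weightedNormSq, conjTranspose_smul, Matrix.smul_mul, Matrix.smul_mul,
    Matrix.mul_smul, smul_smul, trace_smul, RCLike.star_def, Complex.mul_conj', smul_eq_mul,
    ← Complex.ofReal_pow, Complex.re_ofReal_mul]

theorem norm_le_one_of_weightedNormSq_smul_le (hρ : ρ.PosDef) {X : Matrix m n ℂ} (hX : X ≠ 0)
    {z : ℂ} (h : weightedNormSq ρ (z • X) ≤ weightedNormSq ρ X) : ‖z‖ ≤ 1 := by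
  have hpos : 0 < weightedNormSq ρ X :=
    (weightedNormSq_nonneg hρ.posSemidef X).lt_of_ne'
      (mt (weightedNormSq_eq_zero_iff hρ).mp hX)
  rw [weightedNormSq_smul, mul_le_iff_le_one_left hpos] at h
  exact (sq_le_one_iff₀ (norm_nonneg z)).mp h

end WeightedNorm

section MixedChannel

variable {d D D' : ℕ} {A : Tensor d D} {B : Tensor d D'} {ρ : Matrix (Fin D') (Fin D') ℂ}

/-- The map `X ↦ ∑ₛ (Aˢ)† X Bˢ`, by which `mixedTransfer A B` acts on row vectors `vec X`. -/
def mixedChannel (A : Tensor d D) (B : Tensor d D') (X : Matrix (Fin D) (Fin D') ℂ) :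
    Matrix (Fin D) (Fin D') ℂ :=
  ∑ s, (A s)ᴴ * X * B s

theorem vec_vecMul_mixedTransfer (A : Tensor d D) (B : Tensor d D')
    (X : Matrix (Fin D) (Fin D') ℂ) :
    vec X ᵥ* mixedTransfer A B = vec (mixedChannel A B X) := by
  simp only [mixedTransfer, mixedChannel, vecMul_sum, vec_sum, vec_vecMul_kronecker]
  rfl

theorem transferMatrix_mulVec_vec_transpose (A : Tensor d D) (X : Matrix (Fin D) (Fin D) ℂ) :
    transferMatrix A *ᵥ vec Xᵀ = vec (∑ s, A s * X * (A s)ᴴ)ᵀ := by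
  simp only [transferMatrix, sum_mulVec, transpose_sum, vec_sum, kronecker_mulVec_vec,
    transpose_mul, ← mul_assoc]
  rfl

theorem sum_mul_mul_conjTranspose_eq_of_transferMatrix_eq {A B : Tensor d D}
    (h : transferMatrix B = transferMatrix A) (X : Matrix (Fin D) (Fin D) ℂ) :
    ∑ s, B s * X * (B s)ᴴ = ∑ s, A s * X * (A s)ᴴ := by
  rw [← transpose_inj, ← vec_inj, ← transferMatrix_mulVec_vec_transpose, h,
    transferMatrix_mulVec_vec_transpose]

/-- Pythagoras for the map `X ↦ (X Bˢ)ₛ`, isometric for `ρ`, followed by the projection onto the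
range of the isometry `Y ↦ (Aˢ Y)ₛ`. -/
theorem sum_weightedNormSq_sub (hA : ∑ s, (A s)ᴴ * A s = 1) (hB : ∑ s, B s * ρ * (B s)ᴴ = ρ)
    (X : Matrix (Fin D) (Fin D') ℂ) :
    ∑ s, weightedNormSq ρ (X * B s - A s * mixedChannel A B X) =
      weightedNormSq ρ X - weightedNormSq ρ (mixedChannel A B X) := by
  set Y := mixedChannel A B X
  have hsummand : ∀ s, ((X * B s - A s * Y) * ρ * (X * B s - A s * Y)ᴴ).trace =
      (X * (B s * ρ * (B s)ᴴ) * Xᴴ).trace - (Y * ρ * ((A s)ᴴ * X * B s)ᴴ).trace -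
        ((A s)ᴴ * X * B s * (ρ * Yᴴ)).trace + ((A s)ᴴ * A s * (Y * ρ * Yᴴ)).trace := fun s => by
    have hcross : ((A s * Y) * ρ * (X * B s)ᴴ).trace = (Y * ρ * ((A s)ᴴ * X * B s)ᴴ).trace := by
      rw [Matrix.mul_assoc (A s), Matrix.mul_assoc (A s), Matrix.trace_mul_comm]
      simp only [conjTranspose_mul, conjTranspose_conjTranspose, Matrix.mul_assoc]
    have hcross' : ((X * B s) * ρ * (A s * Y)ᴴ).trace =
        ((A s)ᴴ * X * B s * (ρ * Yᴴ)).trace := by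
      rw [conjTranspose_mul, ← Matrix.mul_assoc, Matrix.trace_mul_comm]
      simp only [Matrix.mul_assoc]
    have hdiag : ((A s * Y) * ρ * (A s * Y)ᴴ).trace = ((A s)ᴴ * A s * (Y * ρ * Yᴴ)).trace := by
      rw [conjTranspose_mul, ← Matrix.mul_assoc, Matrix.trace_mul_comm]
      simp only [Matrix.mul_assoc]
    rw [← hcross, ← hcross', ← hdiag]
    simp only [conjTranspose_sub, Matrix.sub_mul, Matrix.mul_sub, trace_sub, conjTranspose_mul,
      Matrix.mul_assoc]
    ring
  simp only [weightedNormSq, hsummand, ← Complex.re_sum, ← Complex.sub_re]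
  congr 1
  have hYdef : ∑ s, (A s)ᴴ * X * B s = Y := rfl
  simp only [Finset.sum_add_distrib, Finset.sum_sub_distrib, ← trace_sum, ← Matrix.sum_mul,
    ← Matrix.mul_sum, ← conjTranspose_sum, hA, hB, hYdef, Matrix.one_mul]
  rw [Matrix.mul_assoc Y]
  ring

theorem weightedNormSq_mixedChannel_le (hρ : ρ.PosSemidef) (hA : ∑ s, (A s)ᴴ * A s = 1)
    (hB : ∑ s, B s * ρ * (B s)ᴴ = ρ) (X : Matrix (Fin D) (Fin D') ℂ) :
    weightedNormSq ρ (mixedChannel A B X) ≤ weightedNormSq ρ X := by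
  rw [← sub_nonneg, ← sum_weightedNormSq_sub hA hB]
  exact Finset.sum_nonneg fun s _ => weightedNormSq_nonneg hρ _

theorem mul_eq_mul_mixedChannel (hρ : ρ.PosDef) (hA : ∑ s, (A s)ᴴ * A s = 1)
    (hB : ∑ s, B s * ρ * (B s)ᴴ = ρ) {X : Matrix (Fin D) (Fin D') ℂ}
    (h : weightedNormSq ρ X ≤ weightedNormSq ρ (mixedChannel A B X)) (s : Fin d) :
    X * B s = A s * mixedChannel A B X := by
  have hnonneg : ∀ s ∈ Finset.univ, 0 ≤ weightedNormSq ρ (X * B s - A s * mixedChannel A B X) :=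
    fun s _ => weightedNormSq_nonneg hρ.posSemidef _
  have hsum := (sum_weightedNormSq_sub hA hB X).trans_le (sub_nonpos.mpr h)
  have hzero := (Finset.sum_eq_zero_iff_of_nonneg hnonneg).mp
    (hsum.antisymm (Finset.sum_nonneg hnonneg)) s (Finset.mem_univ s)
  exact sub_eq_zero.mp ((weightedNormSq_eq_zero_iff hρ).mp hzero)

theorem mixedChannel_conjTranspose_mul_self (hA : ∑ s, (A s)ᴴ * A s = 1)
    {X Y : Matrix (Fin D) (Fin D') ℂ} (hXY : ∀ s, X * B s = A s * Y) :
    mixedChannel B B (Xᴴ * X) = Yᴴ * Y := by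
  have hsummand : ∀ s, (B s)ᴴ * (Xᴴ * X) * B s = Yᴴ * ((A s)ᴴ * A s) * Y := fun s => by
    calc (B s)ᴴ * (Xᴴ * X) * B s = (X * B s)ᴴ * (X * B s) := by
          simp only [conjTranspose_mul, Matrix.mul_assoc]
      _ = Yᴴ * ((A s)ᴴ * A s) * Y := by
          rw [hXY]
          simp only [conjTranspose_mul, Matrix.mul_assoc]
  simp only [mixedChannel, hsummand, ← Matrix.sum_mul, ← Matrix.mul_sum, hA, Matrix.mul_one]

end MixedChannel

section Propagation

variable {d D D' L : ℕ} {A : Tensor d D} {B : Fin L → Tensor d D'}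
  {ρ : Matrix (Fin D') (Fin D') ℂ}

/-- The matrix on bond `j` of a unit cell with tensors `B`, obtained from a matrix `X` on the
leftmost bond by applying the mixed channels of `A` and `B` site by site. -/
def propagate (A : Tensor d D) (B : Fin L → Tensor d D') (X : Matrix (Fin D) (Fin D') ℂ)
    (j : Fin (L + 1)) : Matrix (Fin D) (Fin D') ℂ :=
  Fin.induction X (fun i Y => mixedChannel A (B i) Y) j

@[simp]
theorem propagate_zero (A : Tensor d D) (B : Fin L → Tensor d D')
    (X : Matrix (Fin D) (Fin D') ℂ) : propagate A B X 0 = X := rfl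

theorem propagate_succ (A : Tensor d D) (B : Fin L → Tensor d D')
    (X : Matrix (Fin D) (Fin D') ℂ) (j : Fin L) :
    propagate A B X j.succ = mixedChannel A (B j) (propagate A B X j.castSucc) := rfl

theorem vec_propagate (A : Tensor d D) (B : Fin L → Tensor d D') (X : Matrix (Fin D) (Fin D') ℂ)
    (j : Fin (L + 1)) :
    vec (propagate A B X j) = vec X ᵥ* Fin.partialProd (fun i => mixedTransfer A (B i)) j := by
  induction j using Fin.induction with
  | zero => simp
  | succ j ih =>
    rw [propagate_succ, ← vec_vecMul_mixedTransfer, ih, Fin.partialProd_succ, vecMul_vecMul]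

theorem vec_propagate_last (A : Tensor d D) (B : Fin L → Tensor d D')
    (X : Matrix (Fin D) (Fin D') ℂ) :
    vec (propagate A B X (Fin.last L)) =
      vec X ᵥ* (List.ofFn fun i => mixedTransfer A (B i)).prod := by
  rw [vec_propagate, Fin.partialProd, Fin.val_last, List.take_of_length_le (by simp)]

theorem exists_propagate_last_eq_smul {z : ℂ}
    (hz : z ∈ spectrum ℂ (List.ofFn fun i => mixedTransfer A (B i)).prod) :
    ∃ X ≠ 0, propagate A B X (Fin.last L) = z • X := by
  obtain ⟨x, hx, hzx⟩ := exists_vecMul_eq_smul_of_mem_spectrum hz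
  obtain ⟨X, rfl⟩ := vec_bijective.surjective x
  refine ⟨X, mt vec_eq_zero_iff.mpr hx, ?_⟩
  rw [← vec_inj, vec_propagate_last, hzx, vec_smul]

theorem antitone_weightedNormSq_propagate (hρ : ρ.PosSemidef) (hA : ∑ s, (A s)ᴴ * A s = 1)
    (hB : ∀ j, ∑ s, B j s * ρ * (B j s)ᴴ = ρ) (X : Matrix (Fin D) (Fin D') ℂ) :
    Antitone fun j => weightedNormSq ρ (propagate A B X j) :=
  Fin.antitone_iff_succ_le.mpr fun j => by
    simpa only [propagate_succ] using weightedNormSq_mixedChannel_le hρ hA (hB j) _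

theorem norm_le_one_of_propagate_last_eq_smul (hρ : ρ.PosDef) (hA : ∑ s, (A s)ᴴ * A s = 1)
    (hB : ∀ j, ∑ s, B j s * ρ * (B j s)ᴴ = ρ) {X : Matrix (Fin D) (Fin D') ℂ} (hX : X ≠ 0)
    {z : ℂ} (hz : propagate A B X (Fin.last L) = z • X) : ‖z‖ ≤ 1 :=
  norm_le_one_of_weightedNormSq_smul_le hρ hX <| by
    simpa only [hz, propagate_zero] using
      antitone_weightedNormSq_propagate hρ.posSemidef hA hB X (Fin.zero_le (Fin.last L))

theorem propagate_castSucc_mul_eq (hρ : ρ.PosDef) (hA : ∑ s, (A s)ᴴ * A s = 1)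
    (hB : ∀ j, ∑ s, B j s * ρ * (B j s)ᴴ = ρ) {X : Matrix (Fin D) (Fin D') ℂ}
    (hX : weightedNormSq ρ X ≤ weightedNormSq ρ (propagate A B X (Fin.last L)))
    (j : Fin L) (s : Fin d) :
    propagate A B X j.castSucc * B j s = A s * propagate A B X j.succ := by
  have hanti := antitone_weightedNormSq_propagate hρ.posSemidef hA hB X
  rw [propagate_succ]
  refine mul_eq_mul_mixedChannel hρ hA (hB j) ?_ s
  rw [← propagate_succ]
  calc weightedNormSq ρ (propagate A B X j.castSucc)
      ≤ weightedNormSq ρ (propagate A B X 0) := hanti (Fin.zero_le _)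
    _ ≤ weightedNormSq ρ (propagate A B X (Fin.last L)) := hX
    _ ≤ weightedNormSq ρ (propagate A B X j.succ) := hanti (Fin.le_last _)

end Propagation

section Injective

variable {d D : ℕ} {A : Tensor d D} {ρ : Matrix (Fin D) (Fin D) ℂ}

theorem vec_one_vecMul_transferMatrix (hA : ∑ s, (A s)ᴴ * A s = 1) :
    vec 1 ᵥ* transferMatrix A = vec 1 := by
  rw [← mixedTransfer_self, vec_vecMul_mixedTransfer, mixedChannel]
  simp only [mul_one, hA]

theorem norm_le_one_of_mem_spectrum_transferMatrix (hρ : ρ.PosDef)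
    (hA : ∑ s, (A s)ᴴ * A s = 1) (hAρ : ∑ s, A s * ρ * (A s)ᴴ = ρ) {z : ℂ}
    (hz : z ∈ spectrum ℂ (transferMatrix A)) : ‖z‖ ≤ 1 := by
  obtain ⟨X, hX, hzX⟩ := exists_propagate_last_eq_smul (A := A) (B := fun _ : Fin 1 => A) (z := z)
    (by simpa [mixedTransfer_self] using hz)
  exact norm_le_one_of_propagate_last_eq_smul hρ hA (fun _ => hAρ) hX hzX

namespace IsInjective

theorem neZero (hinj : IsInjective A) : NeZero D := by
  refine ⟨?_⟩
  rintro rfl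
  obtain ⟨μ, hμ, -⟩ := hinj
  simp [Module.finrank_zero_of_subsingleton] at hμ

theorem dominant_eigenvalue_eq_one (hinj : IsInjective A) (hρ : ρ.PosDef)
    (hA : ∑ s, (A s)ᴴ * A s = 1) (hAρ : ∑ s, A s * ρ * (A s)ᴴ = ρ) :
    Module.finrank ℂ (Module.End.eigenspace (toLin' (transferMatrix A)) 1) = 1 ∧
      ∀ z, Module.End.HasEigenvalue (toLin' (transferMatrix A)) z → z ≠ 1 → ‖z‖ < 1 := by
  have := hinj.neZero
  obtain ⟨μ, hμ, hdom⟩ := hinj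
  have hone : Module.End.HasEigenvalue (toLin' (transferMatrix A)) 1 := by
    refine Module.End.hasEigenvalue_of_hasEigenvector (x := vec ρᵀ) ⟨?_, fun h => ?_⟩
    · rw [Module.End.mem_eigenspace_iff, toLin'_apply, transferMatrix_mulVec_vec_transpose, hAρ,
        one_smul]
    · rw [vec_eq_zero_iff, transpose_eq_zero] at h
      simpa [h] using hρ.trace_pos
  have hμ_spec : μ ∈ spectrum ℂ (transferMatrix A) := by
    rw [← spectrum_toLin', ← Module.End.hasEigenvalue_iff_mem_spectrum,
      Module.End.hasEigenvalue_iff]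
    intro hbot
    rw [hbot, finrank_bot] at hμ
    exact zero_ne_one hμ
  obtain rfl : μ = 1 := by
    by_contra hne
    have hlt := hdom 1 hone (Ne.symm hne)
    rw [norm_one] at hlt
    exact hlt.not_ge (norm_le_one_of_mem_spectrum_transferMatrix hρ hA hAρ hμ_spec)
  exact ⟨hμ, by simpa only [norm_one] using hdom⟩

theorem tendsto_transferMatrix_pow (hinj : IsInjective A) (hρ : ρ.PosDef)
    (hA : ∑ s, (A s)ᴴ * A s = 1) (hAρ : ∑ s, A s * ρ * (A s)ᴴ = ρ) :
    Tendsto (fun k : ℕ => transferMatrix A ^ k) atTop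
      (𝓝 (vecMulVec (ρ.trace⁻¹ • vec ρᵀ) (vec 1))) := by
  have := hinj.neZero
  obtain ⟨hsimple, hdom⟩ := hinj.dominant_eigenvalue_eq_one hρ hA hAρ
  refine tendsto_pow_vecMulVec ?_ (vec_one_vecMul_transferMatrix hA) ?_ hsimple hdom
  · rw [mulVec_smul, transferMatrix_mulVec_vec_transpose, hAρ]
  · rw [dotProduct_smul, vec_dotProduct_vec, transpose_one, one_mul, trace_transpose, smul_eq_mul,
      inv_mul_cancel₀ hρ.trace_pos.ne']

theorem tendsto_norm_trace_transferMatrix_pow (hinj : IsInjective A) (hρ : ρ.PosDef)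
    (hA : ∑ s, (A s)ᴴ * A s = 1) (hAρ : ∑ s, A s * ρ * (A s)ᴴ = ρ) :
    Tendsto (fun k : ℕ => ‖(transferMatrix A ^ k).trace‖) atTop (𝓝 1) := by
  have := hinj.neZero
  have hlim := tendsto_norm_trace (hinj.tendsto_transferMatrix_pow hρ hA hAρ)
  rwa [trace_vecMulVec, smul_dotProduct, vec_dotProduct_vec, transpose_transpose, mul_one,
    smul_eq_mul, inv_mul_cancel₀ hρ.trace_pos.ne', norm_one] at hlim

theorem exists_eq_smul_one_of_vecMul_pow_eq (hinj : IsInjective A) (hcan : IsLeftCanonical A)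
    {L : ℕ} (hL : 0 < L) {Q : Matrix (Fin D) (Fin D) ℂ}
    (hQ : vec Q ᵥ* transferMatrix A ^ L = vec Q) : ∃ c : ℂ, Q = c • 1 := by
  obtain ⟨ρ, hρ, hAρ⟩ := hcan.right_fixed
  have hcells : ∀ k : ℕ, vec Q ᵥ* transferMatrix A ^ (L * k) = vec Q := fun k => by
    induction k with
    | zero => simp
    | succ k ih => rw [Nat.mul_succ, pow_add, ← vecMul_vecMul, ih, hQ]
  have hcont : Continuous fun M : Matrix (Fin D × Fin D) (Fin D × Fin D) ℂ => vec Q ᵥ* M :=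
    continuous_const.matrix_vecMul continuous_id
  have hlim := (hcont.tendsto _).comp ((hinj.tendsto_transferMatrix_pow hρ hcan.left_fixed hAρ).comp
      (tendsto_id.const_mul_atTop' hL))
  have hvec := tendsto_nhds_unique (hlim.congr hcells) tendsto_const_nhds
  simp only [vecMul_vecMulVec, ← vec_smul, vec_inj] at hvec
  exact ⟨_, hvec.symm⟩

end IsInjective

end Injective

section BondUnitaries

theorem exists_pos_eq_of_conjTranspose_mul_self_eq_smul_one {m n : Type*} [Fintype m] [Finite n]
    [DecidableEq n] {X : Matrix m n ℂ} (hX : X ≠ 0) {c : ℂ} (h : Xᴴ * X = c • 1) :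
    ∃ r : ℝ, 0 < r ∧ (r : ℂ) = c := by
  cases nonempty_fintype n
  have hpos : 0 < (Xᴴ * X).trace :=
    (posSemidef_conjTranspose_mul_self X).trace_nonneg.lt_of_ne'
      (mt trace_conjTranspose_mul_self_eq_zero_iff.mp hX)
  rw [h, trace_smul, trace_one, smul_eq_mul] at hpos
  exact RCLike.pos_iff_exists_ofReal.mp (pos_of_mul_pos_left hpos (Nat.cast_nonneg _))

theorem inv_sqrt_smul_mem_unitaryGroup {n : Type*} [Fintype n] [DecidableEq n]
    {X : Matrix n n ℂ} {r : ℝ} (hr : 0 < r) (h : Xᴴ * X = (r : ℂ) • 1) :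
    (√r)⁻¹ • X ∈ unitaryGroup n ℂ := by
  rw [mem_unitaryGroup_iff', star_eq_conjTranspose, conjTranspose_smul, star_trivial,
    smul_mul_smul_comm, h, ← mul_inv, Real.mul_self_sqrt hr.le, Complex.coe_smul,
    inv_smul_smul₀ hr.ne']

theorem eq_bondAction_of_mul_eq {d D : ℕ} {A B : Tensor d D} {v w : unitaryGroup (Fin D) ℂ}
    (h : ∀ s, (v : Matrix (Fin D) (Fin D) ℂ) * B s = A s * (w : Matrix (Fin D) (Fin D) ℂ)) :
    B = bondAction v w A := by
  funext s
  rw [bondAction, mul_assoc, ← h, ← mul_assoc, ← star_eq_conjTranspose,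
    mem_unitaryGroup_iff'.mp v.2, one_mul]

variable {d D L : ℕ} {A : Tensor d D} {B : Fin L → Tensor d D}

theorem exists_propagate_conjTranspose_mul_self_eq_smul_one (hcan : IsLeftCanonical A)
    (hinj : IsInjective A) (hL : 0 < L) (hB : ∀ j, transferMatrix (B j) = transferMatrix A)
    {X : Matrix (Fin D) (Fin D) ℂ} {z : ℂ} (hz : ‖z‖ = 1)
    (hlast : propagate A B X (Fin.last L) = z • X)
    (hmul : ∀ j s, propagate A B X j.castSucc * B j s = A s * propagate A B X j.succ) :
    ∃ c : ℂ, ∀ j, (propagate A B X j)ᴴ * propagate A B X j = c • 1 := by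
  have hgram : ∀ j : Fin L,
      vec ((propagate A B X j.castSucc)ᴴ * propagate A B X j.castSucc) ᵥ* transferMatrix A =
        vec ((propagate A B X j.succ)ᴴ * propagate A B X j.succ) := fun j => by
    rw [← hB j, ← mixedTransfer_self, vec_vecMul_mixedTransfer,
      mixedChannel_conjTranspose_mul_self hcan.left_fixed (hmul j)]
  have hgram_pow : ∀ j : Fin (L + 1), vec (Xᴴ * X) ᵥ* transferMatrix A ^ (j : ℕ) =
      vec ((propagate A B X j)ᴴ * propagate A B X j) := fun j => by
    induction j using Fin.induction with
    | zero => simp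
    | succ j ih =>
      rw [Fin.val_succ, pow_succ, ← vecMul_vecMul, ← Fin.val_castSucc, ih, hgram]
  have hcell : vec (Xᴴ * X) ᵥ* transferMatrix A ^ L = vec (Xᴴ * X) := by
    have h := hgram_pow (Fin.last L)
    rwa [Fin.val_last, hlast, conjTranspose_smul, smul_mul_smul_comm, RCLike.star_def,
      RCLike.conj_mul, hz, RCLike.ofReal_one, one_pow, one_smul] at h
  obtain ⟨c, hc⟩ := hinj.exists_eq_smul_one_of_vecMul_pow_eq hcan hL hcell
  refine ⟨c, fun j => ?_⟩
  induction j using Fin.induction with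
  | zero => exact hc
  | succ j ih =>
    rw [← vec_inj, ← hgram, ih, vec_smul, smul_vecMul,
      vec_one_vecMul_transferMatrix hcan.left_fixed]

theorem eqUpToPhase_of_eq_smul {M : Type*} [MulAction ℂ M] {z : ℂ} (hz : ‖z‖ = 1)
    {x y : M} (h : y = z • x) : EqUpToPhase x y := by
  have hexp : z = Complex.exp (Complex.arg z * Complex.I) := by
    simpa [hz] using (Complex.norm_mul_exp_arg_mul_I z).symm
  refine ⟨-Complex.arg z, ?_⟩
  rw [h, smul_smul]
  nth_rw 2 [hexp]
  simp [← Complex.exp_add]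

theorem exists_bondAction_of_mem_spectrum (hcan : IsLeftCanonical A) (hinj : IsInjective A)
    (hL : 0 < L) (hB : ∀ j, transferMatrix (B j) = transferMatrix A) {z : ℂ}
    (hz : z ∈ spectrum ℂ (List.ofFn fun j => mixedTransfer A (B j)).prod) (hz1 : 1 ≤ ‖z‖) :
    ∃ v : Fin (L + 1) → unitaryGroup (Fin D) ℂ,
      (∀ j : Fin L, B j = bondAction (v j.castSucc) (v j.succ) A) ∧
      EqUpToPhase (v 0 : Matrix (Fin D) (Fin D) ℂ) (v (Fin.last L)) := by
  obtain ⟨ρ, hρ, hAρ⟩ := hcan.right_fixed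
  have hBρ : ∀ j, ∑ s, B j s * ρ * (B j s)ᴴ = ρ := fun j =>
    (sum_mul_mul_conjTranspose_eq_of_transferMatrix_eq (hB j) ρ).trans hAρ
  obtain ⟨X, hX, hlast⟩ := exists_propagate_last_eq_smul hz
  have hz_norm : ‖z‖ = 1 :=
    (norm_le_one_of_propagate_last_eq_smul hρ hcan.left_fixed hBρ hX hlast).antisymm hz1
  have hmul := propagate_castSucc_mul_eq hρ hcan.left_fixed hBρ (X := X)
    (by rw [hlast, weightedNormSq_smul, hz_norm, one_pow, one_mul])
  obtain ⟨c, hc⟩ :=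
    exists_propagate_conjTranspose_mul_self_eq_smul_one hcan hinj hL hB hz_norm hlast hmul
  obtain ⟨r, hr, rfl⟩ := exists_pos_eq_of_conjTranspose_mul_self_eq_smul_one hX (hc 0)
  refine ⟨fun j => ⟨_, inv_sqrt_smul_mem_unitaryGroup hr (hc j)⟩,
    fun j => eq_bondAction_of_mul_eq fun s => ?_, eqUpToPhase_of_eq_smul hz_norm ?_⟩
  · rw [smul_mul_assoc, hmul, mul_smul_comm]
  · change (√r)⁻¹ • propagate A B X (Fin.last L) = z • (√r)⁻¹ • propagate A B X 0
    rw [hlast, propagate_zero, smul_comm]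

theorem exists_mem_spectrum_one_le_norm_of_frequently_symmetric (hcan : IsLeftCanonical A)
    (hinj : IsInjective A) (hL : 0 < L) {U : Fin L → unitaryGroup (Fin d) ℂ}
    (hsym : ∃ᶠ k in atTop,
      EqUpToPhase (onSiteOperator (periodicExtension U k) *ᵥ periodicState A (k * L))
        (periodicState A (k * L))) :
    ∃ z ∈ spectrum ℂ (List.ofFn fun j => mixedTransfer A (physicalAction (U j) A)).prod,
      1 ≤ ‖z‖ := by
  obtain ⟨ρ, hρ, hAρ⟩ := hcan.right_fixed
  have hnorm := (hinj.tendsto_norm_trace_transferMatrix_pow hρ hcan.left_fixed hAρ).comp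
    (tendsto_id.atTop_mul_const' hL)
  refine exists_mem_spectrum_one_le_norm one_half_pos
    ((hsym.and_eventually (hnorm.eventually_const_le one_half_lt_one)).mono ?_)
  rintro k ⟨hk, hle⟩
  exact (norm_trace_mixedTransfer_pow_eq hk).symm ▸ hle

end BondUnitaries

end ModulatedMPS

end

open ModulatedMPS in
theorem mainTheorem1_general {d D L : ℕ} (A : Tensor d D) (hcan : IsLeftCanonical A)
    (hinj : IsInjective A) (U : Fin L → unitaryGroup (Fin d) ℂ)
    (hsym : ∃ᶠ k in Filter.atTop,
      EqUpToPhase (onSiteOperator (periodicExtension U k) *ᵥ periodicState A (k * L))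
        (periodicState A (k * L))) :
    ∃ v : Fin (L + 1) → unitaryGroup (Fin D) ℂ,
      (∀ j : Fin L, physicalAction (U j) A = bondAction (v j.castSucc) (v j.succ) A) ∧
      EqUpToPhase (v 0 : Matrix (Fin D) (Fin D) ℂ) (v (Fin.last L)) := by
  rcases Nat.eq_zero_or_pos L with rfl | hL
  · exact ⟨fun _ => 1, fun j => j.elim0, 0, by simp⟩
  obtain ⟨z, hz, hz1⟩ :=
    exists_mem_spectrum_one_le_norm_of_frequently_symmetric hcan hinj hL hsym
  exact exists_bondAction_of_mem_spectrum hcan hinj hL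
    (fun j => transferMatrix_physicalAction (U j) A) hz hz1

theorem mainTheorem1 {G : Type*} {d D L : ℕ}
    (A : ModulatedMPS.Tensor d D)
    (hcan : ModulatedMPS.IsLeftCanonical A)
    (hinj : ModulatedMPS.IsInjective A)
    (U : G → Fin L → Matrix.unitaryGroup (Fin d) ℂ)
    (hsym : ∀ (g : G) (k : ℕ), 1 ≤ k →
      ModulatedMPS.EqUpToPhase
        (ModulatedMPS.onSiteOperator (ModulatedMPS.periodicExtension (U g) k) *ᵥ
          ModulatedMPS.periodicState A (k * L))
        (ModulatedMPS.periodicState A (k * L))) :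
    ∃ v : G → Fin (L + 1) → Matrix.unitaryGroup (Fin D) ℂ, ∀ g : G,
      (∀ j : Fin L, ModulatedMPS.EqUpToPhase
        (ModulatedMPS.physicalAction (U g j) A)
        (ModulatedMPS.bondAction (v g j.castSucc) (v g j.succ) A)) ∧
      ModulatedMPS.EqUpToPhase
        (v g 0 : Matrix (Fin D) (Fin D) ℂ)
        (v g (Fin.last L) : Matrix (Fin D) (Fin D) ℂ) := by
  choose v hv hloop using fun g => mainTheorem1_general A hcan hinj (U g)
    ((Filter.eventually_ge_atTop 1).mono (hsym g)).frequently
  exact ⟨v, fun g => ⟨fun j => ⟨0, by simp [hv g j]⟩, hloop g⟩⟩
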